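/- Let $p$ be an odd prime, fix algebraic closures $\overline{\mathbb Q}$, $\overline{\mathbb Q}_p$, $\overline{\mathbb F}_p$ of $\mathbb Q$, $\mathbb Q_p$, $\mathbb F_p$ and an embedding $\overline{\mathbb Q}\to\overline{\mathbb Q}_p$, and let $I_p\subset \mathrm{Gal}(\overline{\mathbb Q}_p/\mathbb Q_p)$ be the inertia group. Let $p^\star=\left(\frac{-1}{p}\right)p$. A representation $\bar\rho:\mathrm{Gal}(\overline{\mathbb Q}/\mathbb Q)\to \mathrm{GL}_2(\overline{\mathbb F}_p)$ is called odd if every complex conjugation has determinant $-1$ under $\bar\rho$, and bad dihedral if it is irreducible but its restriction to $\mathrm{Gal}(\overline{\mathbb Q}/\mathbb Q(\sqrt{p^\star}))$ is reducible. Let $\chi$ be the mod $p$ cyclotomic character of $I_p$, and let $\psi,\psi'=\psi^p:I_p\to\overline{\mathbb F}_p^\times$ be the fundamental characters of level $2$, i.e. $\sigma\mapsto \sigma(\pi)/\pi$ with $\pi^{p^2-1}=p$, reduced and embedded in $\overline{\mathbb F}_p$. Serre's weight $k(\bar\rho)$ depends only on $\bar\rho|_{I_p}$ and is defined as follows. 1.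 If $\bar\rho|_{I_p}\simeq \psi^a\psi'^b\oplus\psi'^a\psi^b$ with $0\le a<b\le p-1$ (niveau 2), then $k(\bar\rho)=1+pa+b$. 2. If $\bar\rho|_{I_p}\simeq \chi^a\oplus\chi^b$ with $0\le a\le b\le p-2$, then $k(\bar\rho)=1+pa+b$ if $(a,b)\ne(0,0)$, and $k(\bar\rho)=p$ if $a=b=0$. 3. If wild inertia acts non-trivially and $\bar\rho|_{I_p}\simeq\begin{pmatrix}\chi^\beta&*\\0&\chi^\alpha\end{pmatrix}$ with $0\le\alpha\le p-2$, $1\le\beta\le p-1$, put $a=\min(\alpha,\beta)$, $b=\max(\alpha,\beta)$; then $k(\bar\rho)=1+pa+b$, unless $\beta=\alpha+1$ and $\bar\rho$ is très ramifiée at $p$, in which case $k(\bar\rho)=1+pa+b+(p-1)$. Here, for $\beta=\alpha+1$, $\bar\rho$ is peu ramifiée at $p$ if the extension of the maximal unramified extension $\mathbb Q_p^{\mathrm{nr}}$ cut out by $\bar\rho|_{I_p}$ is contained in the one generated by all $p$-th roots of units of $\mathbb Q_p^{\mathrm{nr}}$, and très ramifiée otherwise. Cases 2 and 3 are called niveau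 1; equivalently, the two characters of $I_p$ on the semisimplification of $\bar\rho|_{I_p}$ are powers of $\chi$. Let $\bar\rho:\mathrm{Gal}(\overline{\mathbb Q}/\mathbb Q)\to \mathrm{GL}_2(\overline{\mathbb F}_p)$ be a continuous odd bad dihedral representation, normalised by a twist so that $2\le k(\bar\rho)\le p+1$. Then either $\bar\rho$ is of niveau 2 and $p=2k(\bar\rho)-3$, or $\bar\rho$ is of niveau 1 and $p=2k(\bar\rho)-1$. -/

import Mathlib

open scoped Valued

noncomputable section

namespace GaloisRep

/-! ## Local Galois theory at `p` -/

section Local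

variable (p : ℕ) [Fact p.Prime]

/-- The inertia subgroup `I_p` of `Gal(ℚ̄_p/ℚ_p)`: the automorphisms acting trivially on the residue
field of `ℚ̄_p` (the norm on `ℚ̄_p` is the one extending the `p`-adic norm). -/
def inertia : Subgroup Gal(PadicAlgCl p/ℚ_[p]) where
  carrier := {σ | ∀ x : PadicAlgCl p, ‖x‖ ≤ 1 → ‖σ x - x‖ < 1}
  one_mem' := by
    intro x _
    simp
  mul_mem' := by
    intro σ τ hσ hτ x hx
    have h1 : ‖τ x‖ = ‖x‖ := (spectralNorm_eq_of_equiv (K := ℚ_[p]) τ x).symm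
    have h2 := hσ (τ x) (h1.le.trans hx)
    have h3 := hτ x hx
    have h4 : (σ * τ) x - x = (σ (τ x) - τ x) + (τ x - x) := by
      rw [AlgEquiv.mul_apply]; ring
    rw [h4]
    exact lt_of_le_of_lt (PadicAlgCl.isNonarchimedean p _ _) (max_lt h2 h3)
  inv_mem' := by
    intro σ hσ x hx
    have h1 : ‖σ⁻¹ x‖ = ‖x‖ := (spectralNorm_eq_of_equiv (K := ℚ_[p]) σ⁻¹ x).symm
    have h2 := hσ (σ⁻¹ x) (h1.le.trans hx)
    have h3 : σ (σ⁻¹ x) = x := by rw [← AlgEquiv.mul_apply, mul_inv_cancel, AlgEquiv.one_apply]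
    rw [h3] at h2
    rwa [norm_sub_rev]

/-- The wild inertia subgroup of `Gal(ℚ̄_p/ℚ_p)`, as a set: the automorphisms `σ` such that
`σ x / x` reduces to `1` in the residue field for every `x ≠ 0`. -/
def wildInertia : Set Gal(PadicAlgCl p/ℚ_[p]) :=
  {σ | ∀ x : PadicAlgCl p, x ≠ 0 → ‖σ x / x - 1‖ < 1}

/-- The maximal unramified extension `ℚ_p^nr` of `ℚ_p` inside `ℚ̄_p`. -/
def maxUnramified : IntermediateField ℚ_[p] (PadicAlgCl p) :=
  IntermediateField.fixedField (inertia p)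

/-- The mod `p` cyclotomic character `χ` restricted to inertia, with values in `𝔽̄_p`. -/
def cyclo : inertia p →* (AlgebraicClosure (ZMod p))ˣ :=
  (Units.map (algebraMap (ZMod p) (AlgebraicClosure (ZMod p))).toMonoidHom).comp
    ((modularCyclotomicCharacter (PadicAlgCl p)
        (HasEnoughRootsOfUnity.natCard_rootsOfUnity (PadicAlgCl p) p)).comp
      ((MulSemiringAction.toRingAut Gal(PadicAlgCl p/ℚ_[p]) (PadicAlgCl p)).comp
        (inertia p).subtype))

variable {p}

/-- `ψ` is one of the two fundamental characters of level (niveau) `2` of the inertia group: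
`ψ(σ)` is the image of `σ(π)/π`, where `π ^ (p ^ 2 - 1) = p`, under a ring homomorphism from the
integers of `ℚ̄_p` to `𝔽̄_p`. The other fundamental character of level `2` is `ψ ^ p`. -/
def IsFundamentalTwo (ψ : inertia p →* (AlgebraicClosure (ZMod p))ˣ) : Prop :=
  ∃ (r : 𝒪[PadicAlgCl p] →+* AlgebraicClosure (ZMod p)) (π : PadicAlgCl p),
    π ^ (p ^ 2 - 1) = (p : PadicAlgCl p) ∧
      ∀ σ : inertia p, ∃ u : 𝒪[PadicAlgCl p],
        (u : PadicAlgCl p) = (σ : Gal(PadicAlgCl p/ℚ_[p])) π / π ∧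
          (ψ σ : AlgebraicClosure (ZMod p)) = r u

variable (r : Gal(PadicAlgCl p/ℚ_[p]) →* GL (Fin 2) (AlgebraicClosure (ZMod p)))

/-- In a suitable basis, the restriction of `r` to inertia is upper triangular with
diagonal characters `φ, φ'` (in this order). -/
def IsTriangularOnInertia (φ φ' : inertia p →* (AlgebraicClosure (ZMod p))ˣ) : Prop :=
  ∃ P : GL (Fin 2) (AlgebraicClosure (ZMod p)), ∀ σ : inertia p,
    ∃ u : AlgebraicClosure (ZMod p),
      ((P * r σ * P⁻¹ : GL (Fin 2) (AlgebraicClosure (ZMod p))) :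
        Matrix (Fin 2) (Fin 2) (AlgebraicClosure (ZMod p))) =
          !![(φ σ : AlgebraicClosure (ZMod p)), u; 0, (φ' σ : AlgebraicClosure (ZMod p))]

/-- In a suitable basis, the restriction of `r` to inertia is diagonal, equal to `φ ⊕ φ'`. -/
def IsDiagonalOnInertia (φ φ' : inertia p →* (AlgebraicClosure (ZMod p))ˣ) : Prop :=
  ∃ P : GL (Fin 2) (AlgebraicClosure (ZMod p)), ∀ σ : inertia p,
    ((P * r σ * P⁻¹ : GL (Fin 2) (AlgebraicClosure (ZMod p))) :
      Matrix (Fin 2) (Fin 2) (AlgebraicClosure (ZMod p))) =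
        !![(φ σ : AlgebraicClosure (ZMod p)), 0; 0, (φ' σ : AlgebraicClosure (ZMod p))]

/-- `r` is tamely ramified: wild inertia acts trivially. -/
def IsTame : Prop :=
  ∀ σ ∈ wildInertia p, r σ = 1

/-- Niveau `1`: the characters of inertia on the semisimplification of `r` have level `1`, i.e.
are powers of the mod `p` cyclotomic character. -/
def IsNiveauOne : Prop :=
  ∃ α β : ℕ, IsTriangularOnInertia r (cyclo p ^ β) (cyclo p ^ α)

/-- Niveau `2`: inertia acts through two conjugate characters `φ, φ ^ p` of level `2`, where
`φ = ψ ^ n` is a power of a fundamental character of level `2` that is not of level `1`. -/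
def IsNiveauTwo : Prop :=
  ∃ (ψ : inertia p →* (AlgebraicClosure (ZMod p))ˣ) (n : ℕ),
    IsFundamentalTwo ψ ∧ ¬ (p + 1 ∣ n) ∧ IsDiagonalOnInertia r (ψ ^ n) (ψ ^ (p * n))

/-- "Peu ramifiée": the extension of `ℚ_p^nr` cut out by `r` restricted to inertia is contained in
the extension generated by the `p`-th roots of the units of `ℚ_p^nr`. -/
def IsPeuRamifiee : Prop :=
  IntermediateField.fixedField (r.ker ⊓ inertia p) ≤
    IntermediateField.adjoin ℚ_[p]
      ((maxUnramified p : Set (PadicAlgCl p)) ∪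
        {x : PadicAlgCl p | x ^ p ∈ maxUnramified p ∧ ‖x‖ = 1})

/-- `IsSerreWeight r k`: Serre's recipe (for odd `p`) attaches the weight `k` to `r`. -/
inductive IsSerreWeight : ℕ → Prop
  /-- Level `2`: the characters are `ψ^a ψ'^b` and `ψ'^a ψ^b` with `ψ' = ψ^p` and
  `0 ≤ a < b ≤ p - 1`. -/
  | niveauTwo (ψ : inertia p →* (AlgebraicClosure (ZMod p))ˣ) (a b : ℕ)
      (hψ : IsFundamentalTwo ψ) (hab : a < b) (hb : b ≤ p - 1)
      (hr : IsDiagonalOnInertia r (ψ ^ a * (ψ ^ p) ^ b) ((ψ ^ p) ^ a * ψ ^ b)) :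
      IsSerreWeight (1 + p * a + b)
  /-- Level `1`, tame: `χ^a ⊕ χ^b` with `0 ≤ a ≤ b ≤ p - 2`, not both zero. -/
  | niveauOneTame (a b : ℕ) (hab : a ≤ b) (hb : b ≤ p - 2) (h0 : ¬ (a = 0 ∧ b = 0))
      (hr : IsDiagonalOnInertia r (cyclo p ^ a) (cyclo p ^ b)) :
      IsSerreWeight (1 + p * a + b)
  /-- Level `1`, tame, both exponents zero: inertia acts trivially. -/
  | niveauOneUnramified (hr : IsDiagonalOnInertia r (cyclo p ^ 0) (cyclo p ^ 0)) :
      IsSerreWeight p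
  /-- Level `1`, wild: `χ^β * ; 0 χ^α` with `0 ≤ α ≤ p - 2`, `1 ≤ β ≤ p - 1`, `β ≠ α + 1`. -/
  | niveauOneWild (α β : ℕ) (hα : α ≤ p - 2) (hβ : 1 ≤ β) (hβ' : β ≤ p - 1) (hαβ : β ≠ α + 1)
      (hr : IsTriangularOnInertia r (cyclo p ^ β) (cyclo p ^ α)) (hw : ¬ IsTame r) :
      IsSerreWeight (1 + p * min α β + max α β)
  /-- Level `1`, wild, `β = α + 1`, peu ramifiée. -/
  | niveauOnePeu (α β : ℕ) (hα : α ≤ p - 2) (hβ : 1 ≤ β) (hβ' : β ≤ p - 1) (hαβ : β = α + 1)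
      (hr : IsTriangularOnInertia r (cyclo p ^ β) (cyclo p ^ α)) (hw : ¬ IsTame r)
      (hpeu : IsPeuRamifiee r) :
      IsSerreWeight (1 + p * min α β + max α β)
  /-- Level `1`, wild, `β = α + 1`, très ramifiée. -/
  | niveauOneTres (α β : ℕ) (hα : α ≤ p - 2) (hβ : 1 ≤ β) (hβ' : β ≤ p - 1) (hαβ : β = α + 1)
      (hr : IsTriangularOnInertia r (cyclo p ^ β) (cyclo p ^ α)) (hw : ¬ IsTame r)
      (htres : ¬ IsPeuRamifiee r) :
      IsSerreWeight (1 + p * min α β + max α β + (p - 1))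

end Local

/-! ## Global Galois representations -/

section Global

variable {p : ℕ} [Fact p.Prime]

instance isAlgClosure_rat : IsAlgClosure ℚ (AlgebraicClosure ℚ) where
  isAlgClosed := inferInstance
  isAlgebraic := AlgebraicClosure.isAlgebraic ℚ

instance normal_rat : Normal ℚ (AlgebraicClosure ℚ) := IsAlgClosure.normal ℚ (AlgebraicClosure ℚ)

/-- The homomorphism `Gal(ℚ̄_p/ℚ_p) → Gal(ℚ̄/ℚ)` restricting automorphisms along an embedding
`ι : ℚ̄ → ℚ̄_p`. -/
def restrict (ι : AlgebraicClosure ℚ →+* PadicAlgCl p) :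
    Gal(PadicAlgCl p/ℚ_[p]) →* Gal(AlgebraicClosure ℚ/ℚ) :=
  letI : Algebra (AlgebraicClosure ℚ) (PadicAlgCl p) := ι.toAlgebra
  haveI : IsScalarTower ℚ (AlgebraicClosure ℚ) (PadicAlgCl p) :=
    IsScalarTower.of_algebraMap_eq' (Subsingleton.elim _ _)
  (AlgEquiv.restrictNormalHom (F := ℚ) (K₁ := PadicAlgCl p) (AlgebraicClosure ℚ)).comp
    (AlgEquiv.restrictScalarsHom ℚ)

theorem restrict_spec (ι : AlgebraicClosure ℚ →+* PadicAlgCl p)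
    (σ : Gal(PadicAlgCl p/ℚ_[p])) (x : AlgebraicClosure ℚ) :
    ι (restrict ι σ x) = σ (ι x) := by
  let : Algebra (AlgebraicClosure ℚ) (PadicAlgCl p) := ι.toAlgebra
  have : IsScalarTower ℚ (AlgebraicClosure ℚ) (PadicAlgCl p) :=
    IsScalarTower.of_algebraMap_eq' (Subsingleton.elim _ _)
  exact AlgEquiv.restrictNormal_commutes
    (AlgEquiv.restrictScalarsHom ℚ σ : Gal(PadicAlgCl p/ℚ)) (AlgebraicClosure ℚ) x

/-- Continuity for the Krull topology on `Gal(ℚ̄/ℚ)` and the discrete topology on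
`GL₂(𝔽̄_p)`. -/
def IsContinuous
    (ρ : Gal(AlgebraicClosure ℚ/ℚ) →* GL (Fin 2) (AlgebraicClosure (ZMod p))) : Prop :=
  letI : TopologicalSpace (GL (Fin 2) (AlgebraicClosure (ZMod p))) := ⊥
  Continuous ρ

/-- `ρ` is odd: complex conjugations have determinant `-1`. -/
def IsOdd (ρ : Gal(AlgebraicClosure ℚ/ℚ) →* GL (Fin 2) (AlgebraicClosure (ZMod p))) : Prop :=
  ∀ (φ : AlgebraicClosure ℚ →+* ℂ) (c : Gal(AlgebraicClosure ℚ/ℚ)),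
    NumberField.ComplexEmbedding.IsConj φ c → Matrix.GeneralLinearGroup.det (ρ c) = -1

/-- The representation on `F²` given by a homomorphism to `GL₂(F)`. -/
def toRepresentation {G F : Type*} [Group G] [Field F] (ρ : G →* GL (Fin 2) F) :
    Representation F G (Fin 2 → F) :=
  (Matrix.toLinAlgEquiv' : Matrix (Fin 2) (Fin 2) F ≃ₐ[F] _).toMonoidHom.comp
    ((Units.coeHom _).comp ρ)

/-- The integer `p* = (-1/p) p`. -/
def pStar (p : ℕ) [Fact p.Prime] : ℤ := legendreSym p (-1) * p

/-- The subgroup `Gal_{ℚ(√p*)}` of `Gal(ℚ̄/ℚ)`. -/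
def galSqrtPStar (p : ℕ) [Fact p.Prime] : Subgroup Gal(AlgebraicClosure ℚ/ℚ) :=
  (IntermediateField.adjoin ℚ
    {x : AlgebraicClosure ℚ | x ^ 2 = ((pStar p : ℤ) : AlgebraicClosure ℚ)}).fixingSubgroup

/-- `ρ` is bad dihedral: it is irreducible, but its restriction to `Gal_{ℚ(√p*)}` is reducible. -/
def IsBadDihedral
    (ρ : Gal(AlgebraicClosure ℚ/ℚ) →* GL (Fin 2) (AlgebraicClosure (ZMod p))) : Prop :=
  (toRepresentation ρ).IsIrreducible ∧
    ¬ (toRepresentation (ρ.comp (galSqrtPStar p).subtype)).IsIrreducible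

end Global

end GaloisRep

end

/-! Let `H` be the Galois group of `ℚ(√p*)`. Bad dihedrality gives a line stable under `H` and under
no element outside `H`. Two consequences carry the proof. Outside `H` the trace of `ρ` vanishes
(`trace_eq_zero_of_isBadDihedral`), since `g ^ 2 ∈ H`. A unipotent element lies in `H` and fixes two
distinct lines, so it is trivial (`eq_one_of_isBadDihedral`); hence niveau 1 forces tameness, and
the wild cases of Serre's recipe disappear.

Since `√p*` is ramified at `p`, inertia contains elements outside `H`. More precisely, inertia
permutes transitively the roots of a monic degree `n` polynomial having a root of norm `p ^ (-1 /
n)` (`exists_mem_inertia_apply_eq`). Hence there is an inertial `σ` negating `√p*` on which `χ`,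
respectively `ψ`, takes a value of exact order `p - 1`, respectively `p ^ 2 - 1`.

The range of `k` forces `a = 0` and `k = 1 + b` in the remaining cases, apart from trivial inertia,
which is excluded. Trace zero at `σ` then reads `χ(σ) ^ b = -1`, so `2b = p - 1`, or `ψ(σ) ^ ((p -
1) b) = -1`, so `2b = p + 1`. -/

noncomputable section

namespace GaloisRep

/-! ### Plane representations that become reducible on a subgroup of index two. -/

section Dihedral

variable {G F : Type*} [Group G] [Field F]

theorem toRepresentation_apply (ρ : G →* GL (Fin 2) F) (g : G) (v : Fin 2 → F) :
    toRepresentation ρ g v = (ρ g).val.mulVec v := rfl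

/-- A group acting irreducibly on `F²` but reducibly on a subgroup has a line stable under exactly
the subgroup, provided the subgroup has index at most two. -/
theorem exists_line_stable (ρ : G →* GL (Fin 2) F) (H : Subgroup G)
    (hH : ∀ g h, g ∉ H → h ∉ H → g * h ∈ H)
    (hirr : (toRepresentation ρ).IsIrreducible)
    (hred : ¬ (toRepresentation (ρ.comp H.subtype)).IsIrreducible) :
    ∃ v : Fin 2 → F, v ≠ 0 ∧ (∀ h ∈ H, ∃ c : F, (ρ h).val.mulVec v = c • v) ∧
      ∀ g ∉ H, ¬ ∃ c : F, (ρ g).val.mulVec v = c • v := by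
  have hnt : Nontrivial (Subrepresentation (toRepresentation (ρ.comp H.subtype))) := by
    refine ⟨⊥, ⊤, fun h => ?_⟩
    have h1 : (fun _ => 1 : Fin 2 → F) ∈
        (⊥ : Subrepresentation (toRepresentation (ρ.comp H.subtype))) := by
      rw [h]; trivial
    exact one_ne_zero (congrFun (show (fun _ => 1 : Fin 2 → F) = 0 from h1) 0)
  obtain ⟨W, hW0, hW1⟩ : ∃ W : Subrepresentation (toRepresentation (ρ.comp H.subtype)),
      W ≠ ⊥ ∧ W ≠ ⊤ := by
    by_contra! hcon
    exact hred { hnt with eq_bot_or_eq_top := fun W => or_iff_not_imp_left.2 (hcon W) }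
  have hW0' : W.toSubmodule ≠ ⊥ := fun h => hW0 (Subrepresentation.toSubmodule_injective h)
  have hW1' : W.toSubmodule ≠ ⊤ := fun h => hW1 (Subrepresentation.toSubmodule_injective h)
  have hfr : Module.finrank F W.toSubmodule = 1 := by
    have h1 := Submodule.finrank_lt hW1'
    have h2 : Module.finrank F W.toSubmodule ≠ 0 := fun h => hW0' (Submodule.finrank_eq_zero.1 h)
    simp at h1
    omega
  obtain ⟨⟨v, hvW⟩, hv0, hv⟩ := finrank_eq_one_iff'.1 hfr
  have hv0' : v ≠ 0 := fun h => hv0 (Subtype.ext h)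
  have hWv : ∀ w ∈ W.toSubmodule, ∃ c : F, w = c • v := fun w hw => by
    obtain ⟨c, hc⟩ := hv ⟨w, hw⟩
    exact ⟨c, (congrArg Subtype.val hc).symm⟩
  have hstab : ∀ h ∈ H, ∃ c : F, (ρ h).val.mulVec v = c • v := fun h hh =>
    hWv _ (W.apply_mem_toSubmodule ⟨h, hh⟩ hvW)
  refine ⟨v, hv0', hstab, ?_⟩
  rintro g hg ⟨c, hc⟩
  -- If `g ∉ H` preserved the line, so would every `x ∉ H`, as `x = (x g⁻¹) g` with `x g⁻¹ ∈ H`;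
  -- this contradicts irreducibility.
  have hall : ∀ x : G, ∃ d : F, (ρ x).val.mulVec v = d • v := by
    intro x
    by_cases hx : x ∈ H
    · exact hstab x hx
    · have hg' : g⁻¹ ∉ H := fun h => hg (inv_mem_iff.1 h)
      obtain ⟨d, hd⟩ := hstab _ (hH x g⁻¹ hx hg')
      refine ⟨c * d, ?_⟩
      have : ρ x = ρ (x * g⁻¹) * ρ g := by rw [← map_mul, inv_mul_cancel_right]
      rw [this, Units.val_mul, ← Matrix.mulVec_mulVec, hc, Matrix.mulVec_smul, hd, smul_smul]
  let U : Subrepresentation (toRepresentation ρ) :=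
    { toSubmodule := W.toSubmodule
      apply_mem_toSubmodule := fun x w hw => by
        obtain ⟨a, rfl⟩ := hWv w hw
        obtain ⟨d, hd⟩ := hall x
        rw [map_smul, toRepresentation_apply, hd]
        exact W.toSubmodule.smul_mem _ (W.toSubmodule.smul_mem _ hvW) }
  rcases hirr.eq_bot_or_eq_top U with h | h
  · exact hW0' (congrArg Subrepresentation.toSubmodule h)
  · exact hW1' (congrArg Subrepresentation.toSubmodule h)

/-- A `2 × 2` matrix whose square stabilizes a line that it does not itself stabilize has
trace zero. -/
theorem trace_eq_zero_of_sq_mulVec (A : Matrix (Fin 2) (Fin 2) F) (v : Fin 2 → F)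
    (h2 : ∃ c : F, (A * A).mulVec v = c • v) (h1 : ¬ ∃ c : F, A.mulVec v = c • v) :
    A.trace = 0 := by
  by_contra ht
  obtain ⟨c, hc⟩ := h2
  -- By Cayley–Hamilton, if the trace is nonzero then `A` is a linear combination of `A * A` and
  -- `1`, so it preserves every line that `A * A` does.
  have hCH : A * A = A.trace • A - A.det • (1 : Matrix (Fin 2) (Fin 2) F) := by
    ext i j
    fin_cases i <;> fin_cases j <;>
      simp [Matrix.mul_apply, Fin.sum_univ_two, Matrix.trace, Matrix.det_fin_two] <;> ring
  rw [hCH, Matrix.sub_mulVec, Matrix.smul_mulVec, Matrix.smul_mulVec, Matrix.one_mulVec,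
    sub_eq_iff_eq_add] at hc
  refine h1 ⟨A.trace⁻¹ * (c + A.det), ?_⟩
  rw [mul_smul, add_smul, ← hc, smul_smul, inv_mul_cancel₀ ht, one_smul]

/-- An element of the stabilizer `H` of a line, whose matrix is conjugate to an upper
triangular unipotent one, acts trivially as soon as `H` is normal of index two. -/
theorem eq_one_of_unipotent (ρ : G →* GL (Fin 2) F) (H : Subgroup G)
    (hH : ∀ g h, g ∉ H → h ∉ H → g * h ∈ H) {v : Fin 2 → F} (hv : v ≠ 0)
    (hstab : ∀ h ∈ H, ∃ c : F, (ρ h).val.mulVec v = c • v) {g : G} (hg : g ∉ H)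
    (hgv : ¬ ∃ c : F, (ρ g).val.mulVec v = c • v) {h : G} (hh : h ∈ H)
    {P : GL (Fin 2) F} {u : F} (hP : (P * ρ h * P⁻¹).val = !![1, u; 0, 1]) : ρ h = 1 := by
  have hnil : ((ρ h).val - 1) * ((ρ h).val - 1) = 0 := by
    have e : (ρ h).val - 1 = P⁻¹.val * (!![1, u; 0, 1] - 1) * P.val := by
      have : (ρ h).val = P⁻¹.val * !![1, u; 0, 1] * P.val := by
        rw [← hP, ← Units.val_mul, ← Units.val_mul]
        congr 1; group
      rw [this, mul_sub, sub_mul, mul_one, Units.inv_mul]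
    rw [e]
    calc _ = P⁻¹.val * ((!![1, u; 0, 1] - 1) * (P.val * P⁻¹.val) * (!![1, u; 0, 1] - 1)) *
          P.val := by simp only [mul_assoc]
      _ = 0 := by
        rw [Units.mul_inv, mul_one]
        have : (!![1, u; 0, 1] - 1 : Matrix (Fin 2) (Fin 2) F) * (!![1, u; 0, 1] - 1) = 0 := by
          ext i j
          fin_cases i <;> fin_cases j <;> simp [Matrix.mul_apply, Fin.sum_univ_two]
        rw [this, mul_zero, zero_mul]
  -- A unipotent matrix has `1` as its only eigenvalue.
  have hfix : ∀ w : Fin 2 → F, w ≠ 0 → (∃ c : F, (ρ h).val.mulVec w = c • w) →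
      (ρ h).val.mulVec w = w := by
    rintro w hw ⟨c, hc⟩
    have h1 : ((ρ h).val - 1).mulVec w = (c - 1) • w := by
      rw [Matrix.sub_mulVec, hc, Matrix.one_mulVec, sub_smul, one_smul]
    have h2 : ((c - 1) * (c - 1)) • w = 0 := by
      rw [← smul_smul, ← h1, ← Matrix.mulVec_smul, ← h1, Matrix.mulVec_mulVec, hnil,
        Matrix.zero_mulVec]
    have h3 : c = 1 := by
      rcases smul_eq_zero.1 h2 with h3 | h3
      · exact sub_eq_zero.1 (mul_self_eq_zero.1 h3)
      · exact absurd h3 hw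
    rw [hc, h3, one_smul]
  -- `H` is normal, so `w` spans a second `H`-stable line; `ρ h` fixes the basis `v, w`.
  set w := (ρ g).val.mulVec v with hwdef
  have hv1 := hfix v hv (hstab h hh)
  have hw0 : w ≠ 0 := fun h0 => hgv ⟨0, by rw [h0, zero_smul]⟩
  have hconj : g⁻¹ * h * g ∈ H := by
    by_contra hc
    have h1 : h * g ∉ H := fun h1 => hg ((H.mul_mem_cancel_left hh).1 h1)
    have h2 := hH g _ hg hc
    exact h1 (by simpa [mul_assoc] using h2)
  have hw1 := hfix w hw0 (by
    obtain ⟨c, hc⟩ := hstab _ hconj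
    refine ⟨c, ?_⟩
    have e : ρ h * ρ g = ρ g * ρ (g⁻¹ * h * g) := by
      rw [← map_mul, ← map_mul]; congr 1; group
    rw [hwdef, Matrix.mulVec_mulVec, ← Units.val_mul, e, Units.val_mul, ← Matrix.mulVec_mulVec, hc,
      Matrix.mulVec_smul])
  have hli : LinearIndependent F ![v, w] := by
    rw [LinearIndependent.pair_iff' hv]
    exact fun a ha => hgv ⟨a, ha.symm⟩
  let b := basisOfLinearIndependentOfCardEqFinrank hli (by simp)
  have hb : Matrix.mulVecLin (ρ h).val = LinearMap.id := by
    refine b.ext fun i => ?_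
    fin_cases i
    · simpa [b] using hv1
    · simpa [b] using hw1
  refine Units.ext (Matrix.toLin'.injective ?_)
  rw [Units.val_one, Matrix.toLin'_one]
  exact hb

end Dihedral

/-! ### The subgroup fixing `ℚ(√p*)` and its consequences for bad dihedral representations. -/

section Quadratic

variable {p : ℕ} [Fact p.Prime]

theorem pStar_ne_zero : pStar p ≠ 0 := by
  have h : p.Prime := Fact.out
  refine mul_ne_zero ?_ (Int.natCast_ne_zero.2 h.ne_zero)
  rw [Ne, legendreSym.eq_zero_iff]
  simp

theorem mem_galSqrtPStar {s : AlgebraicClosure ℚ}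
    (hs : s ^ 2 = ((pStar p : ℤ) : AlgebraicClosure ℚ)) (g : Gal(AlgebraicClosure ℚ/ℚ)) :
    g ∈ galSqrtPStar p ↔ g s = s := by
  rw [galSqrtPStar, IntermediateField.mem_fixingSubgroup_iff]
  constructor
  · intro h
    exact h s (IntermediateField.subset_adjoin _ _ hs)
  · intro h x hx
    refine (IntermediateField.forall_mem_adjoin_smul_eq_self_iff ℚ
      (S := {x : AlgebraicClosure ℚ | x ^ 2 = ((pStar p : ℤ) : AlgebraicClosure ℚ)}) g).2 ?_ x hx
    intro y hy
    have hy' : y ^ 2 = s ^ 2 := by rw [hs]; exact hy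
    rcases sq_eq_sq_iff_eq_or_eq_neg.1 hy' with rfl | rfl
    · exact h
    · change g (-s) = -s
      rw [map_neg, h]

theorem apply_sqrt_eq_neg {s : AlgebraicClosure ℚ}
    (hs : s ^ 2 = ((pStar p : ℤ) : AlgebraicClosure ℚ)) {g : Gal(AlgebraicClosure ℚ/ℚ)}
    (hg : g ∉ galSqrtPStar p) : g s = -s := by
  have h : (g s) ^ 2 = s ^ 2 := by rw [← map_pow, hs, map_intCast]
  rw [mem_galSqrtPStar hs] at hg
  exact (sq_eq_sq_iff_eq_or_eq_neg.1 h).resolve_left hg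

theorem mul_mem_galSqrtPStar (g h : Gal(AlgebraicClosure ℚ/ℚ)) (hg : g ∉ galSqrtPStar p)
    (hh : h ∉ galSqrtPStar p) : g * h ∈ galSqrtPStar p := by
  obtain ⟨s, hs⟩ := IsAlgClosed.exists_pow_nat_eq
    ((pStar p : ℤ) : AlgebraicClosure ℚ) (n := 2) two_pos
  rw [mem_galSqrtPStar hs, AlgEquiv.mul_apply, apply_sqrt_eq_neg hs hh, map_neg,
    apply_sqrt_eq_neg hs hg, neg_neg]

/-- An automorphism of `ℚ̄_p` negating a square root of `p*` restricts to one that does not fix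
`ℚ(√p*)`. -/
theorem restrict_notMem_galSqrtPStar (ι : AlgebraicClosure ℚ →+* PadicAlgCl p)
    {σ : Gal(PadicAlgCl p/ℚ_[p])} {t : PadicAlgCl p}
    (ht : t ^ 2 = ((pStar p : ℤ) : PadicAlgCl p)) (hσ : σ t = -t) :
    restrict ι σ ∉ galSqrtPStar p := by
  obtain ⟨s, hs⟩ := IsAlgClosed.exists_pow_nat_eq
    ((pStar p : ℤ) : AlgebraicClosure ℚ) (n := 2) two_pos
  have ht0 : t ≠ 0 := by
    rintro rfl
    rw [zero_pow two_ne_zero, eq_comm, Int.cast_eq_zero] at ht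
    exact pStar_ne_zero ht
  have hst : (ι s) ^ 2 = t ^ 2 := by rw [← map_pow, hs, map_intCast, ht]
  rw [mem_galSqrtPStar hs]
  intro h
  have h1 := restrict_spec ι σ s
  rw [h] at h1
  have h2 : t = -t := by
    rcases sq_eq_sq_iff_eq_or_eq_neg.1 hst with h3 | h3
    · rw [h3, hσ] at h1; exact h1
    · rw [h3, map_neg, hσ] at h1; exact (neg_injective h1)
  exact ht0 (self_eq_neg.1 h2)

theorem trace_eq_zero_of_isBadDihedral
    {ρ : Gal(AlgebraicClosure ℚ/ℚ) →* GL (Fin 2) (AlgebraicClosure (ZMod p))}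
    (hbad : IsBadDihedral ρ) {g : Gal(AlgebraicClosure ℚ/ℚ)} (hg : g ∉ galSqrtPStar p) :
    (ρ g).val.trace = 0 := by
  obtain ⟨v, -, h1, h2⟩ := exists_line_stable ρ _ mul_mem_galSqrtPStar hbad.1 hbad.2
  refine trace_eq_zero_of_sq_mulVec _ v ?_ (h2 g hg)
  rw [← Units.val_mul, ← map_mul]
  exact h1 _ (mul_mem_galSqrtPStar g g hg hg)

theorem eq_one_of_isBadDihedral (hp : p ≠ 2)
    {ρ : Gal(AlgebraicClosure ℚ/ℚ) →* GL (Fin 2) (AlgebraicClosure (ZMod p))}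
    (hbad : IsBadDihedral ρ) {g h : Gal(AlgebraicClosure ℚ/ℚ)} (hg : g ∉ galSqrtPStar p)
    {P : GL (Fin 2) (AlgebraicClosure (ZMod p))} {u : AlgebraicClosure (ZMod p)}
    (hP : (P * ρ h * P⁻¹).val = !![1, u; 0, 1]) : ρ h = 1 := by
  obtain ⟨v, hv, h1, h2⟩ := exists_line_stable ρ _ mul_mem_galSqrtPStar hbad.1 hbad.2
  refine eq_one_of_unipotent ρ _ mul_mem_galSqrtPStar hv h1 hg (h2 g hg) ?_ hP
  -- Outside the subgroup the trace is `0`, whereas a unipotent matrix has trace `2 ≠ 0`.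
  by_contra hh
  have ht := trace_eq_zero_of_isBadDihedral hbad hh
  have ht' := congrArg Matrix.trace hP
  rw [Units.val_mul, Matrix.trace_mul_comm, ← Units.val_mul, inv_mul_cancel_left, ht,
    Matrix.trace_fin_two] at ht'
  have h2 : (2 : AlgebraicClosure (ZMod p)) = 0 := by
    rw [← one_add_one_eq_two]; simpa using ht'.symm
  have : ((2 : ℕ) : AlgebraicClosure (ZMod p)) = 0 := by exact_mod_cast h2
  rw [CharP.cast_eq_zero_iff (AlgebraicClosure (ZMod p)) p,
    Nat.prime_dvd_prime_iff_eq Fact.out Nat.prime_two] at this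
  exact hp this

end Quadratic

/-- If a profinite group `G` acts continuously on a discrete ring `B`, then every automorphism of
`B` stabilizing a prime `Q` and acting trivially modulo `Q` on the `G`-invariants agrees
modulo `Q` with an element of `G`. -/
theorem exists_smul_sub_mem_of_isOpen_stabilizer {B : Type*} [CommRing B] {G : Type*} [Group G]
    [TopologicalSpace G] [CompactSpace G] [TotallyDisconnectedSpace G] [IsTopologicalGroup G]
    [MulSemiringAction G B]
    (hstab : ∀ x : B, IsOpen (MulAction.stabilizer G x : Set G)) (Q : Ideal B) [Q.IsPrime]
    (τ : B ≃+* B) (hτ : ∀ x, τ x ∈ Q ↔ x ∈ Q)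
    (hfix : ∀ a : B, (∀ g : G, g • a = a) → τ a - a ∈ Q) :
    ∃ g : G, ∀ x, g • x - τ x ∈ Q := by
  let _ : TopologicalSpace B := ⊥
  have : DiscreteTopology B := ⟨rfl⟩
  have : ContinuousSMul G B := continuousSMul_iff_stabilizer_isOpen.2 hstab
  let A := FixedPoints.subring B G
  have : SMulCommClass G A B := ⟨fun g a b => by
    change g • (a.1 * b) = a.1 * (g • b)
    rw [smul_mul', a.2 g]⟩
  have : Algebra.IsInvariant A B G := ⟨fun b hb => ⟨⟨b, hb⟩, rfl⟩⟩
  have hmap : Q = Q.map (τ : B →+* B) := by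
    rw [Ideal.map_comap_of_equiv]
    ext x
    change x ∈ Q ↔ τ.symm x ∈ Q
    rw [← hτ (τ.symm x), τ.apply_symm_apply]
  -- By `hfix`, `τ` induces an automorphism of `B ⧸ Q` over the image of the invariants; the
  -- decomposition group surjects onto such automorphisms.
  let e : (B ⧸ Q) ≃ₐ[A ⧸ Q.under A] B ⧸ Q :=
    AlgEquiv.ofRingEquiv (f := Ideal.quotientEquiv Q Q τ hmap) (by
      intro a
      obtain ⟨a, rfl⟩ := Ideal.Quotient.mk_surjective a
      exact Ideal.Quotient.eq.2 (hfix a.1 a.2))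
  obtain ⟨g, hg⟩ := Ideal.Quotient.stabilizerHom_surjective_of_profinite (G := G) (Q.under A) Q e
  exact ⟨g.1, fun x => Ideal.Quotient.eq.1 (DFunLike.congr_fun hg (Ideal.Quotient.mk Q x))⟩

/-! ### Totally ramified extensions of `ℚ_p` and transitivity of inertia. -/

section Ramified

open Polynomial

variable {p : ℕ} [Fact p.Prime]

theorem norm_algEquiv_apply (σ : Gal(PadicAlgCl p/ℚ_[p])) (x : PadicAlgCl p) : ‖σ x‖ = ‖x‖ :=
  (spectralNorm_eq_of_equiv (K := ℚ_[p]) σ x).symm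

theorem norm_natCast_prime : ‖(p : PadicAlgCl p)‖ = (p : ℝ)⁻¹ := by
  rw [← map_natCast (algebraMap ℚ_[p] (PadicAlgCl p)) p]
  exact (PadicAlgCl.norm_extends p (p : ℚ_[p])).trans Padic.norm_p

theorem norm_algebraMap_mul_pow_pow {π : PadicAlgCl p} {n : ℕ} (hπ : ‖π‖ ^ n = (p : ℝ)⁻¹)
    {a : ℚ_[p]} (ha : a ≠ 0) (i : ℕ) :
    ‖algebraMap ℚ_[p] (PadicAlgCl p) a * π ^ i‖ ^ n = (p : ℝ) ^ (-(n * a.valuation + i) : ℤ) := by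
  have hp : (p : ℝ) ≠ 0 := Nat.cast_ne_zero.2 (Fact.out : p.Prime).ne_zero
  have h1 : ‖algebraMap ℚ_[p] (PadicAlgCl p) a‖ = ‖a‖ := PadicAlgCl.norm_extends p a
  rw [norm_mul, norm_pow, h1, mul_pow, ← pow_mul, mul_comm i n, pow_mul, hπ,
    Padic.norm_eq_zpow_neg_valuation ha, ← zpow_natCast, ← zpow_mul, inv_pow, ← zpow_natCast,
    ← zpow_neg, ← zpow_add₀ hp]
  congr 1
  ring

/-- The `n`-th power of the norm is `p ^ (-(n v(a) + i))`, and this exponent modulo `n` determines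
`i < n`. -/
theorem norm_algebraMap_mul_pow_injective {π : PadicAlgCl p} {n : ℕ} (hπ : ‖π‖ ^ n = (p : ℝ)⁻¹)
    {a b : ℚ_[p]} (ha : a ≠ 0) (hb : b ≠ 0) {i j : ℕ} (hi : i < n) (hj : j < n)
    (h : ‖algebraMap ℚ_[p] (PadicAlgCl p) a * π ^ i‖ =
      ‖algebraMap ℚ_[p] (PadicAlgCl p) b * π ^ j‖) : i = j := by
  have hp : (1 : ℝ) < p := Nat.one_lt_cast.2 (Fact.out : p.Prime).one_lt
  have h' := congrArg (· ^ n) h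
  simp only [norm_algebraMap_mul_pow_pow hπ ha, norm_algebraMap_mul_pow_pow hπ hb] at h'
  have h'' := zpow_right_injective₀ (by linarith) hp.ne' h'
  have h3 : (n : ℤ) * a.valuation + i = n * b.valuation + j := neg_injective h''
  have h4 : (i : ℤ) ≡ j [ZMOD n] := by
    refine (Int.emod_emod_of_dvd _ dvd_rfl).symm.trans ?_
    have := congrArg (· % (n : ℤ)) h3
    simpa [Int.ModEq] using this
  rw [Int.natCast_modEq_iff] at h4
  exact h4.eq_of_lt_of_lt hi hj

/-- The expansions in powers of a uniformizer of exact denominator `n`: each term is bounded by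
the sum. -/
theorem norm_term_le_norm_aeval {π : PadicAlgCl p} {n : ℕ} (hπ : ‖π‖ ^ n = (p : ℝ)⁻¹)
    {g : ℚ_[p][X]} (hg : g.natDegree < n) (i : ℕ) :
    ‖algebraMap ℚ_[p] (PadicAlgCl p) (g.coeff i) * π ^ i‖ ≤ ‖aeval π g‖ := by
  by_cases hi : g.coeff i = 0
  · rw [hi]; simp
  -- The terms have pairwise distinct norms, so the norm of the sum is their maximum.
  have h := IsUltrametricDist.nnnorm_sum_eq_sup_of_pairwise_ne (s := g.support)
    (f := fun i => algebraMap ℚ_[p] (PadicAlgCl p) (g.coeff i) * π ^ i) (by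
      intro a ha b hb hab hne
      refine hab (norm_algebraMap_mul_pow_injective hπ (mem_support_iff.1 ha)
        (mem_support_iff.1 hb) ((le_natDegree_of_mem_supp _ ha).trans_lt hg)
        ((le_natDegree_of_mem_supp _ hb).trans_lt hg) (congrArg NNReal.toReal hne)))
  rw [aeval_eq_sum_range]
  have e : ∑ i ∈ Finset.range (g.natDegree + 1), g.coeff i • π ^ i =
      ∑ i ∈ g.support, algebraMap ℚ_[p] (PadicAlgCl p) (g.coeff i) * π ^ i := by
    symm
    refine (Finset.sum_subset supp_subset_range_natDegree_succ ?_).trans ?_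
    · intro x _ hx
      rw [notMem_support_iff.1 hx, map_zero, zero_mul]
    · exact Finset.sum_congr rfl fun x _ => (Algebra.smul_def _ _).symm
  rw [e]
  have h2 := Finset.le_sup (f := fun i => ‖algebraMap ℚ_[p] (PadicAlgCl p) (g.coeff i) * π ^ i‖₊)
    (mem_support_iff.2 hi)
  rw [← h] at h2
  exact_mod_cast h2

/-- Linear independence of `1, π, …, π ^ (n - 1)`, the source of irreducibility: each term is
bounded by the vanishing sum. -/
theorem eq_zero_of_aeval_eq_zero {π : PadicAlgCl p} {n : ℕ} (hn : n ≠ 0)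
    (hπ : ‖π‖ ^ n = (p : ℝ)⁻¹)
    {g : ℚ_[p][X]} (hg : g.natDegree < n) (h : aeval π g = 0) : g = 0 := by
  have hp : (p : ℝ) ≠ 0 := Nat.cast_ne_zero.2 (Fact.out : p.Prime).ne_zero
  have hπ0 : π ≠ 0 := by
    rintro rfl
    rw [norm_zero, zero_pow hn] at hπ
    exact inv_ne_zero hp hπ.symm
  ext i
  have h1 := norm_term_le_norm_aeval hπ hg i
  rw [h, norm_zero, norm_le_zero_iff, mul_eq_zero, or_iff_left (pow_ne_zero _ hπ0),
    map_eq_zero] at h1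
  simpa using h1

/-- A monic polynomial of degree `n` with a root of absolute value `p ^ (-1 / n)` is the minimal
polynomial of that root. -/
theorem minpoly_eq_of_norm_pow {π : PadicAlgCl p} {n : ℕ} (hn : n ≠ 0)
    (hπ : ‖π‖ ^ n = (p : ℝ)⁻¹) {f : ℚ_[p][X]} (hf : f.Monic) (hdeg : f.natDegree = n)
    (h : aeval π f = 0) : minpoly ℚ_[p] π = f := by
  have hint : IsIntegral ℚ_[p] π := ⟨f, hf, h⟩
  have hle : n ≤ (minpoly ℚ_[p] π).natDegree := by
    by_contra! hlt
    exact minpoly.ne_zero hint (eq_zero_of_aeval_eq_zero hn hπ hlt (minpoly.aeval _ _))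
  exact (eq_of_monic_of_dvd_of_natDegree_le (minpoly.monic hint) hf (minpoly.dvd _ _ h)
    (hdeg.trans_le hle)).symm

/-- The residue field of `ℚ_p(π)`, for `π` of absolute value `p ^ (-1 / n)` and degree `n`,
is `𝔽_p`. -/
theorem exists_norm_sub_algebraMap_lt_one {π : PadicAlgCl p} {n : ℕ} (hn : n ≠ 0)
    (hπ : ‖π‖ ^ n = (p : ℝ)⁻¹) {f : ℚ_[p][X]} (hf : f.Monic) (hdeg : f.natDegree = n)
    (h : aeval π f = 0) {x : PadicAlgCl p} (hx : x ∈ IntermediateField.adjoin ℚ_[p] {π})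
    (hx1 : ‖x‖ ≤ 1) : ∃ c : ℚ_[p], ‖x - algebraMap ℚ_[p] (PadicAlgCl p) c‖ < 1 := by
  have hp : (1 : ℝ) < p := Nat.one_lt_cast.2 (Fact.out : p.Prime).one_lt
  have hint : IsIntegral ℚ_[p] π := ⟨f, hf, h⟩
  rw [← IntermediateField.mem_toSubalgebra,
    IntermediateField.adjoin_simple_toSubalgebra_of_isAlgebraic hint.isAlgebraic,
    Algebra.adjoin_singleton_eq_range_aeval] at hx
  obtain ⟨g₀, rfl⟩ := hx
  obtain ⟨g, hg, hgx⟩ : ∃ g : ℚ_[p][X], g.natDegree < n ∧ aeval π g = aeval π g₀ := by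
    refine ⟨g₀ %ₘ f, hdeg ▸ natDegree_modByMonic_lt g₀ hf ?_, ?_⟩
    · rintro rfl
      simp at hdeg
      exact hn hdeg.symm
    · rw [aeval_modByMonic_eq_self_of_root h]
  change ‖aeval π g₀‖ ≤ 1 at hx1
  change ∃ c : ℚ_[p], ‖aeval π g₀ - _‖ < 1
  rw [← hgx] at hx1 ⊢
  refine ⟨g.coeff 0, ?_⟩
  have e : aeval π g - algebraMap ℚ_[p] (PadicAlgCl p) (g.coeff 0) =
      ∑ i ∈ Finset.range g.natDegree,
        algebraMap ℚ_[p] (PadicAlgCl p) (g.coeff (i + 1)) * π ^ (i + 1) := by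
    rw [aeval_eq_sum_range, Finset.sum_range_succ', pow_zero, Algebra.smul_def, mul_one,
      add_sub_cancel_right]
    exact Finset.sum_congr rfl fun x _ => (Algebra.smul_def _ _)
  rw [e]
  rcases Nat.eq_zero_or_pos g.natDegree with h0 | h0
  · rw [h0]; simp
  obtain ⟨i, hi, hle⟩ := IsUltrametricDist.exists_norm_finsetSum_le_of_nonempty
    (Finset.nonempty_range_iff.2 h0.ne') (fun i =>
      algebraMap ℚ_[p] (PadicAlgCl p) (g.coeff (i + 1)) * π ^ (i + 1))
  -- A term of index `i + 1` has norm at most `1`; norm exactly `1` would match that of `1 * π ^ 0`,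
  -- forcing `i + 1 = 0`.
  refine hle.trans_lt (lt_of_le_of_ne ((norm_term_le_norm_aeval hπ hg _).trans hx1) ?_)
  intro h1
  have hin : i + 1 < n := by have := Finset.mem_range.1 hi; omega
  have ha : g.coeff (i + 1) ≠ 0 := by
    intro ha; rw [ha] at h1; simp at h1
  have h2 := norm_algebraMap_mul_pow_injective hπ ha one_ne_zero hin (Nat.pos_of_ne_zero hn)
    (by rw [h1]; simp)
  omega

variable (p) in
/-- The ring of integers of `ℚ̄_p`. -/
def integers : Subring (PadicAlgCl p) where
  carrier := {x | ‖x‖ ≤ 1}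
  mul_mem' {a b} ha hb := by
    change ‖a * b‖ ≤ 1
    rw [norm_mul]
    exact mul_le_one₀ ha (norm_nonneg _) hb
  one_mem' := norm_one.le
  add_mem' {a b} ha hb := (IsUltrametricDist.norm_add_le_max a b).trans (max_le ha hb)
  zero_mem' := by simp
  neg_mem' {a} ha := by simpa using ha

variable (p) in
/-- The maximal ideal of the ring of integers of `ℚ̄_p`. -/
def maximalIdeal : Ideal (integers p) where
  carrier := {x | ‖x.1‖ < 1}
  add_mem' {a b} ha hb := (IsUltrametricDist.norm_add_le_max a.1 b.1).trans_lt (max_lt ha hb)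
  zero_mem' := by simp
  smul_mem' c x hx := by
    change ‖c.1 * x.1‖ < 1
    rw [norm_mul]
    exact mul_lt_one_of_nonneg_of_lt_one_right c.2 (norm_nonneg _) hx

instance : (maximalIdeal p).IsPrime where
  ne_top' h := by
    have h1 : ‖(1 : PadicAlgCl p)‖ < 1 := (Ideal.eq_top_iff_one _).1 h
    simp at h1
  mem_or_mem' {x y} h := by
    by_contra! hc
    have hx : ‖x.1‖ = 1 := le_antisymm x.2 (not_lt.1 hc.1)
    have hy : ‖y.1‖ = 1 := le_antisymm y.2 (not_lt.1 hc.2)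
    have h' : ‖x.1 * y.1‖ < 1 := h
    rw [norm_mul, hx, hy, mul_one] at h'
    exact lt_irrefl _ h'

instance (V : IntermediateField ℚ_[p] (PadicAlgCl p)) :
    MulSemiringAction Gal(PadicAlgCl p/V) (integers p) where
  smul σ x := ⟨σ x.1, (norm_algEquiv_apply (σ.restrictScalars ℚ_[p]) x.1).trans_le x.2⟩
  one_smul _ := rfl
  mul_smul _ _ _ := rfl
  smul_zero σ := Subtype.ext (map_zero σ)
  smul_add σ _ _ := Subtype.ext (map_add σ _ _)
  smul_one σ := Subtype.ext (map_one σ)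
  smul_mul σ _ _ := Subtype.ext (map_mul σ _ _)

/-- The automorphism of the ring of integers induced by an automorphism of `ℚ̄_p`. -/
def integersEquiv (τ : Gal(PadicAlgCl p/ℚ_[p])) : integers p ≃+* integers p where
  toFun x := ⟨τ x.1, (norm_algEquiv_apply τ x.1).trans_le x.2⟩
  invFun x := ⟨τ.symm x.1, (norm_algEquiv_apply τ.symm x.1).trans_le x.2⟩
  left_inv x := Subtype.ext (τ.symm_apply_apply x.1)
  right_inv x := Subtype.ext (τ.apply_symm_apply x.1)
  map_mul' _ _ := Subtype.ext (map_mul τ _ _)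
  map_add' _ _ := Subtype.ext (map_add τ _ _)

/-- Over an intermediate field with residue field `𝔽_p`, every automorphism of `ℚ̄_p` agrees on
the residue field with one fixing that intermediate field. -/
theorem exists_algEquiv_norm_sub_lt_one (V : IntermediateField ℚ_[p] (PadicAlgCl p))
    (hV : ∀ x ∈ V, ‖x‖ ≤ 1 → ∃ c : ℚ_[p], ‖x - algebraMap ℚ_[p] (PadicAlgCl p) c‖ < 1)
    (τ : Gal(PadicAlgCl p/ℚ_[p])) :
    ∃ g : Gal(PadicAlgCl p/V), ∀ x : PadicAlgCl p, ‖x‖ ≤ 1 → ‖g x - τ x‖ < 1 := by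
  have : IsGalois V (PadicAlgCl p) := IsGalois.tower_top_of_isGalois ℚ_[p] V (PadicAlgCl p)
  have hstab (x : integers p) :
      IsOpen (MulAction.stabilizer Gal(PadicAlgCl p/V) x : Set Gal(PadicAlgCl p/V)) := by
    convert stabilizer_isOpen_of_isIntegral (K := V) x.1 using 1
    ext σ
    exact Subtype.ext_iff
  obtain ⟨g, hg⟩ := exists_smul_sub_mem_of_isOpen_stabilizer hstab (maximalIdeal p)
    (integersEquiv τ) (fun x => iff_of_eq (congrArg (· < 1) (norm_algEquiv_apply τ x.1))) (by
      intro a ha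
      change ‖τ a.1 - a.1‖ < 1
      -- Invariants lie in `V`, hence are congruent to elements of `ℚ_p`, which `τ` fixes.
      have haV : a.1 ∈ V := by
        obtain ⟨y, hy⟩ := (InfiniteGalois.mem_range_algebraMap_iff_fixed
          (k := V) (K := PadicAlgCl p) a.1).2 fun g => congrArg Subtype.val (ha g)
        rw [← hy]
        exact y.2
      obtain ⟨c, hc⟩ := hV _ haV a.2
      have hc' : ‖τ a.1 - algebraMap ℚ_[p] (PadicAlgCl p) c‖ < 1 := by
        rw [← τ.commutes c, ← map_sub, norm_algEquiv_apply]
        exact hc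
      rw [← sub_sub_sub_cancel_right _ _ (algebraMap ℚ_[p] (PadicAlgCl p) c), sub_eq_add_neg]
      refine (IsUltrametricDist.norm_add_le_max _ _).trans_lt (max_lt hc' ?_)
      rwa [norm_neg])
  exact ⟨g, fun x hx => hg ⟨x, hx⟩⟩

/-- Inertia acts transitively on the roots of a polynomial of degree `n` with a root of absolute
value `p ^ (-1 / n)`. -/
theorem exists_mem_inertia_apply_eq {π π' : PadicAlgCl p} {n : ℕ} (hn : n ≠ 0)
    (hπ : ‖π‖ ^ n = (p : ℝ)⁻¹) {f : ℚ_[p][X]} (hf : f.Monic) (hdeg : f.natDegree = n)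
    (h : aeval π f = 0) (h' : aeval π' f = 0) : ∃ σ ∈ inertia p, σ π = π' := by
  -- `τ` sends `π` to `π'` but need not be inertial. Some `g` fixing `π` has the same residual
  -- action, and `τ g⁻¹` is then inertial and still sends `π` to `π'`.
  obtain ⟨τ, hτ⟩ := minpoly.exists_algEquiv_of_root' (K := ℚ_[p]) (L := PadicAlgCl p) (x := π')
    (y := π) (Algebra.IsAlgebraic.isAlgebraic π)
    (by rw [minpoly_eq_of_norm_pow hn hπ hf hdeg h]; exact h')
  let V := IntermediateField.adjoin ℚ_[p] {π}
  obtain ⟨g, hg⟩ := exists_algEquiv_norm_sub_lt_one V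
    (fun x hx => exists_norm_sub_algebraMap_lt_one hn hπ hf hdeg h hx) τ
  let g' : Gal(PadicAlgCl p/ℚ_[p]) := g.restrictScalars ℚ_[p]
  have hgπ : g'⁻¹ π = π := by
    change g'.symm π = π
    rw [AlgEquiv.symm_apply_eq]
    exact (g.commutes ⟨π, IntermediateField.mem_adjoin_simple_self ℚ_[p] π⟩).symm
  refine ⟨τ * g'⁻¹, fun x hx => ?_, by rw [AlgEquiv.mul_apply, hgπ, hτ]⟩
  have hx' : ‖g'⁻¹ x‖ ≤ 1 := (norm_algEquiv_apply _ x).trans_le hx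
  have h1 := hg _ hx'
  have h2 : g (g'⁻¹ x) = x := by
    change (g' * g'⁻¹) x = x
    rw [mul_inv_cancel, AlgEquiv.one_apply]
  rwa [h2, norm_sub_rev] at h1

end Ramified

/-! ### Values of `χ` and `ψ` on inertia, and the action on `√p*`. -/

section Uniformizers

open Polynomial

variable {p : ℕ} [Fact p.Prime]

theorem norm_natCast_lt_one_iff (m : ℕ) : ‖(m : PadicAlgCl p)‖ < 1 ↔ p ∣ m := by
  rw [← map_natCast (algebraMap ℚ_[p] (PadicAlgCl p)) m]
  refine (iff_of_eq (congrArg (· < 1) (PadicAlgCl.norm_extends p (m : ℚ_[p])))).trans ?_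
  exact Padic.norm_natCast_lt_one_iff

theorem norm_eq_one_of_pow_eq_one {x : PadicAlgCl p} {n : ℕ} (hn : n ≠ 0) (hx : x ^ n = 1) :
    ‖x‖ = 1 :=
  (pow_eq_one_iff_of_nonneg (norm_nonneg x) hn).1 (by rw [← norm_pow, hx, norm_one])

theorem norm_one_sub_pow_le {x : PadicAlgCl p} (hx : ‖x‖ ≤ 1) (k : ℕ) :
    ‖1 - x ^ k‖ ≤ ‖1 - x‖ := by
  rw [← mul_neg_geom_sum, norm_mul]
  refine mul_le_of_le_one_right (norm_nonneg _) ?_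
  refine IsUltrametricDist.norm_sum_le_of_forall_le_of_nonneg zero_le_one fun i _ => ?_
  rw [norm_pow]
  exact pow_le_one₀ (norm_nonneg _) hx

/-- The product of the `1 - ζ ^ i` for `0 < i < p` is `p`, and all factors have equal norm because
`ζ` and `ζ ^ i` are powers of each other. -/
theorem norm_sub_one_pow_of_isPrimitiveRoot {ζ : PadicAlgCl p} (hζ : IsPrimitiveRoot ζ p) :
    ‖ζ - 1‖ ^ (p - 1) = (p : ℝ)⁻¹ := by
  have hp : p.Prime := Fact.out
  have hζ1 : ‖ζ‖ ≤ 1 := (norm_eq_one_of_pow_eq_one hp.ne_zero hζ.pow_eq_one).le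
  have hpred : p - 1 + 1 = p := Nat.sub_add_cancel hp.one_le
  have h := IsPrimitiveRoot.prod_one_sub_pow_eq_order (n := p - 1) (μ := ζ) (by rwa [hpred])
  have h2 := congrArg norm h
  rw [norm_prod, Finset.prod_congr rfl (g := fun _ => ‖ζ - 1‖), Finset.prod_const,
    Finset.card_range] at h2
  · rw [h2, ← Nat.cast_succ, Nat.succ_eq_add_one, hpred, norm_natCast_prime]
  · intro i hi
    have hi' : i + 1 < p := by have := Finset.mem_range.1 hi; omega
    rw [norm_sub_rev ζ 1]
    refine le_antisymm (norm_one_sub_pow_le hζ1 _) ?_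
    have hcop : (i + 1).Coprime p   :=
      ((hp.coprime_iff_not_dvd).2 (Nat.not_dvd_of_pos_of_lt (Nat.succ_pos i) hi')).symm
    obtain ⟨j, -, hj⟩ := (hζ.pow_of_coprime _ hcop).eq_pow_of_pow_eq_one hζ.pow_eq_one
    calc ‖1 - ζ‖ = ‖1 - (ζ ^ (i + 1)) ^ j‖ := by rw [hj]
      _ ≤ ‖1 - ζ ^ (i + 1)‖ := norm_one_sub_pow_le (by
        rw [norm_pow]; exact pow_le_one₀ (norm_nonneg _) hζ1) _

theorem norm_sub_one_lt_one_of_isPrimitiveRoot {ζ : PadicAlgCl p} (hζ : IsPrimitiveRoot ζ p) :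
    ‖ζ - 1‖ < 1 := by
  have hp : p.Prime := Fact.out
  have h := norm_sub_one_pow_of_isPrimitiveRoot hζ
  by_contra! hc
  have h1 := one_le_pow₀ hc (n := p - 1)
  rw [h] at h1
  exact absurd h1 (not_le.2 (inv_lt_one_of_one_lt₀ (Nat.one_lt_cast.2 hp.one_lt)))

/-- A ring homomorphism to a field in which `n ≠ 0` preserves primitive `n`-th roots of unity. -/
theorem isPrimitiveRoot_map {R K : Type*} [CommRing R] [IsDomain R] [Field K] (r : R →+* K) {u : R}
    {n : ℕ} (hn : 0 < n) (hnK : (n : K) ≠ 0) (hu : IsPrimitiveRoot u n) :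
    IsPrimitiveRoot (r u) n := by
  have : NeZero (n : K) := ⟨hnK⟩
  rw [← isRoot_cyclotomic_iff, ← map_cyclotomic n r]
  exact (hu.isRoot_cyclotomic hn).map

/-- Inertia fixes the square roots of `±1`, for odd `p`. -/
theorem inertia_apply_eq_of_sq (hp : p ≠ 2) {σ : Gal(PadicAlgCl p/ℚ_[p])} (hσ : σ ∈ inertia p)
    {δ : PadicAlgCl p} {ε : ℤ} (hε : ε ^ 2 = 1) (hδ : δ ^ 2 = ε) : σ δ = δ := by
  have hn : ‖δ‖ = 1 := norm_eq_one_of_pow_eq_one (n := 4) four_ne_zero (by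
    rw [show 4 = 2 * 2 from rfl, pow_mul, hδ]; exact_mod_cast hε)
  have h2 : (σ δ) ^ 2 = δ ^ 2 := by rw [← map_pow, hδ, map_intCast]
  refine (sq_eq_sq_iff_eq_or_eq_neg.1 h2).resolve_right fun h => ?_
  -- If `σ δ = -δ`, inertia would give `‖2 δ‖ < 1`, but `2` and `δ` are units.
  have h3 := hσ δ hn.le
  rw [h, show -δ - δ = -(((2 : ℕ) : PadicAlgCl p) * δ) by push_cast; ring, norm_neg, norm_mul, hn,
    mul_one, norm_natCast_lt_one_iff, Nat.prime_dvd_prime_iff_eq Fact.out Nat.prime_two] at h3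
  exact hp h3

theorem legendreSym_neg_one_sq : legendreSym p (-1) ^ 2 = 1 :=
  legendreSym.sq_one p (by simp)

theorem natCast_sq_sub_one_ne_zero :
    ((p ^ 2 - 1 : ℕ) : AlgebraicClosure (ZMod p)) ≠ 0 := by
  have hp : p.Prime := Fact.out
  rw [Ne, CharP.cast_eq_zero_iff (AlgebraicClosure (ZMod p)) p]
  intro h
  have h1 : p ∣ p ^ 2 := dvd_pow_self p two_ne_zero
  have h2 := (Nat.dvd_sub_iff_right (Nat.one_le_pow _ _ hp.pos) h1).1 h
  exact hp.one_lt.ne' (Nat.dvd_one.1 h2)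

theorem sq_sub_one_pos : 0 < p ^ 2 - 1 :=
  Nat.sub_pos_of_lt (Nat.one_lt_pow two_ne_zero (Fact.out : p.Prime).one_lt)

theorem IsFundamentalTwo.pow_sq_sub_one {ψ : inertia p →* (AlgebraicClosure (ZMod p))ˣ}
    (hψ : IsFundamentalTwo ψ) : ψ ^ (p ^ 2 - 1) = 1 := by
  obtain ⟨r, π, hπ, h⟩ := hψ
  ext σ
  obtain ⟨u, hu, hur⟩ := h σ
  have hp0 : (p : PadicAlgCl p) ≠ 0 := Nat.cast_ne_zero.2 (Fact.out : p.Prime).ne_zero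
  have hu1 : u ^ (p ^ 2 - 1) = 1 := by
    apply Subtype.ext
    push_cast
    rw [hu, div_pow, ← map_pow, hπ, map_natCast, div_self hp0]
  rw [MonoidHom.pow_apply, Units.val_pow_eq_pow_val, hur, ← map_pow, hu1, map_one]
  rfl

/-- A fundamental character of level two attains primitive `(p ^ 2 - 1)`-th roots of unity, at
elements of inertia acting nontrivially on `√p*`. -/
theorem IsFundamentalTwo.exists_isPrimitiveRoot (hp : p ≠ 2)
    {ψ : inertia p →* (AlgebraicClosure (ZMod p))ˣ} (hψ : IsFundamentalTwo ψ) :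
    ∃ σ : inertia p, IsPrimitiveRoot (ψ σ : AlgebraicClosure (ZMod p)) (p ^ 2 - 1) ∧
      ∃ t : PadicAlgCl p, t ^ 2 = ((pStar p : ℤ) : PadicAlgCl p) ∧
        (σ : Gal(PadicAlgCl p/ℚ_[p])) t = -t := by
  obtain ⟨r, π, hπ, h⟩ := hψ
  have hprime : p.Prime := Fact.out
  set n := p ^ 2 - 1 with hn
  have hn0 : 0 < n := sq_sub_one_pos
  have : NeZero n := ⟨hn0.ne'⟩
  have hp0 : (p : PadicAlgCl p) ≠ 0 := Nat.cast_ne_zero.2 hprime.ne_zero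
  have hπ0 : π ≠ 0 := by
    rintro rfl
    rw [zero_pow hn0.ne'] at hπ
    exact hp0 hπ.symm
  obtain ⟨ζ, hζ⟩ := HasEnoughRootsOfUnity.exists_primitiveRoot (PadicAlgCl p) n
  -- The roots of `X ^ n - p` are the `n`-th roots of unity times `π`.
  obtain ⟨σ, hσ, hσπ⟩ := exists_mem_inertia_apply_eq (π := π) (π' := ζ * π) hn0.ne'
    (by rw [← norm_pow, hπ, norm_natCast_prime]) (monic_X_pow_sub_C (p : ℚ_[p]) hn0.ne')
    natDegree_X_pow_sub_C (by simp [hπ]) (by simp [mul_pow, hπ, hζ.pow_eq_one])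
  refine ⟨⟨σ, hσ⟩, ?_, ?_⟩
  · obtain ⟨u, hu, hur⟩ := h ⟨σ, hσ⟩
    rw [hur]
    refine isPrimitiveRoot_map r hn0 natCast_sq_sub_one_ne_zero ?_
    refine IsPrimitiveRoot.of_map_of_injective (f := 𝒪[PadicAlgCl p].subtype) ?_
      Subtype.val_injective
    change IsPrimitiveRoot (u : PadicAlgCl p) n
    rw [hu]
    change IsPrimitiveRoot (σ π / π) n
    rwa [hσπ, mul_div_cancel_right₀ _ hπ0]
  -- With `2m = p ^ 2 - 1` and `δ ^ 2 = (-1/p)`, a square root of `p*` is `δ π ^ m`; `σ` fixes `δ`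
  -- and multiplies `π ^ m` by `ζ ^ m = -1`.
  · obtain ⟨m, hm⟩ : ∃ m, n = m * 2 := by
      have h1 : Odd (p ^ 2) := (hprime.odd_of_ne_two hp).pow
      obtain ⟨m, hm⟩ := h1
      exact ⟨m, by omega⟩
    obtain ⟨δ, hδ⟩ := IsAlgClosed.exists_pow_nat_eq
      ((legendreSym p (-1) : ℤ) : PadicAlgCl p) (n := 2) two_pos
    have hm1 : ζ ^ m = -1 := (hζ.pow hn0 hm).eq_neg_one_of_two_right
    refine ⟨δ * π ^ m, ?_, ?_⟩
    · rw [mul_pow, ← pow_mul, ← hm, hπ, hδ, pStar]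
      push_cast
      rfl
    · change σ (δ * π ^ m) = _
      rw [map_mul, map_pow, hσπ, inertia_apply_eq_of_sq hp hσ legendreSym_neg_one_sq hδ, mul_pow,
        hm1]
      ring

theorem modularCyclotomicCharacter_spec {ζ : PadicAlgCl p} (hζ : IsPrimitiveRoot ζ p)
    (σ : Gal(PadicAlgCl p/ℚ_[p])) :
    σ ζ = ζ ^ ((modularCyclotomicCharacter (PadicAlgCl p)
      (HasEnoughRootsOfUnity.natCard_rootsOfUnity (PadicAlgCl p) p)
      (MulSemiringAction.toRingAut _ _ σ) : (ZMod p)ˣ) : ZMod p).val := by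
  have h := modularCyclotomicCharacter.spec (PadicAlgCl p)
    (HasEnoughRootsOfUnity.natCard_rootsOfUnity (PadicAlgCl p) p)
    (MulSemiringAction.toRingAut _ _ σ)
    (t := (hζ.isUnit (NeZero.ne p)).unit) (by
      rw [mem_rootsOfUnity]
      exact Units.ext (by simpa using hζ.pow_eq_one))
  exact h

theorem coe_cyclo_eq {ζ : PadicAlgCl p} (hζ : IsPrimitiveRoot ζ p) {σ : inertia p} {a : ZMod p}
    (h : (σ : Gal(PadicAlgCl p/ℚ_[p])) ζ = ζ ^ a.val) :
    (cyclo p σ : AlgebraicClosure (ZMod p)) = algebraMap (ZMod p) _ a := by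
  rw [modularCyclotomicCharacter_spec hζ] at h
  exact congrArg (algebraMap (ZMod p) (AlgebraicClosure (ZMod p)))
    (ZMod.val_injective p (hζ.pow_inj (ZMod.val_lt _) (ZMod.val_lt _) h))

theorem mem_inertia_of_mem_wildInertia {σ : Gal(PadicAlgCl p/ℚ_[p])} (hσ : σ ∈ wildInertia p) :
    σ ∈ inertia p := by
  intro x hx
  rcases eq_or_ne x 0 with rfl | hx0
  · simp
  · have h : σ x - x = x * (σ x / x - 1) := by field_simp
    rw [h, norm_mul]
    exact mul_lt_one_of_nonneg_of_lt_one_right hx (norm_nonneg _) (hσ x hx0)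

/-- The mod `p` cyclotomic character is trivial on wild inertia. -/
theorem cyclo_eq_one_of_mem_wildInertia {σ : inertia p}
    (hσ : (σ : Gal(PadicAlgCl p/ℚ_[p])) ∈ wildInertia p) : cyclo p σ = 1 := by
  have hp : p.Prime := Fact.out
  obtain ⟨ζ, hζ⟩ := HasEnoughRootsOfUnity.exists_primitiveRoot (PadicAlgCl p) p
  have hζ1 : ‖ζ‖ ≤ 1 := (norm_eq_one_of_pow_eq_one hp.ne_zero hζ.pow_eq_one).le
  have hζ0 : ζ - 1 ≠ 0 := sub_ne_zero.2 (hζ.ne_one hp.one_lt)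
  have hlt := norm_sub_one_lt_one_of_isPrimitiveRoot hζ
  obtain ⟨a, ha⟩ : ∃ a : ZMod p, (σ : Gal(PadicAlgCl p/ℚ_[p])) ζ = ζ ^ a.val :=
    ⟨_, modularCyclotomicCharacter_spec hζ _⟩
  -- If `σ ζ = ζ ^ a`, then `σ(ζ - 1) / (ζ - 1) = 1 + ζ + ⋯ + ζ ^ (a - 1)`, which reduces to `a`;
  -- wildness makes it reduce to `1`.
  have h := hσ (ζ - 1) hζ0
  rw [map_sub, map_one, ha, ← mul_geom_sum, mul_div_cancel_left₀ _ hζ0] at h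
  have hsum : ‖(∑ i ∈ Finset.range a.val, ζ ^ i) - (a.val : PadicAlgCl p)‖ < 1 := by
    have e : (∑ i ∈ Finset.range a.val, ζ ^ i) - (a.val : PadicAlgCl p) =
        ∑ i ∈ Finset.range a.val, (ζ ^ i - 1) := by simp
    rw [e]
    refine (IsUltrametricDist.norm_sum_le_of_forall_le_of_nonneg (norm_nonneg (ζ - 1))
      fun i _ => ?_).trans_lt hlt
    rw [norm_sub_rev, norm_sub_rev ζ]
    exact norm_one_sub_pow_le hζ1 i
  have hone : ‖(a.val : PadicAlgCl p) - 1‖ < 1 := by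
    rw [show (a.val : PadicAlgCl p) - 1 = ((∑ i ∈ Finset.range a.val, ζ ^ i) - 1) +
      -((∑ i ∈ Finset.range a.val, ζ ^ i) - (a.val : PadicAlgCl p)) by ring]
    refine (IsUltrametricDist.norm_add_le_max _ _).trans_lt (max_lt h ?_)
    rwa [norm_neg]
  have ha0 : 1 ≤ a.val := by
    by_contra! hc
    have h0 : a.val = 0 := by omega
    rw [h0] at hone
    simp at hone
  rw [← Nat.cast_one, ← Nat.cast_sub ha0, norm_natCast_lt_one_iff] at hone
  have ha1 : a.val = 1 := by
    have := Nat.eq_zero_of_dvd_of_lt hone (by have := ZMod.val_lt a; omega)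
    omega
  have ha2 : a = 1 := by rw [← ZMod.natCast_zmod_val a, ha1, Nat.cast_one]
  refine Units.ext ?_
  rw [coe_cyclo_eq hζ ha, ha2, map_one, Units.val_one]

/-- The mod `p` cyclotomic character of inertia is surjective onto `𝔽_p^×`, and inertia elements
mapping to a generator act nontrivially on `√p*`. -/
theorem exists_isPrimitiveRoot_cyclo (hp : p ≠ 2) :
    ∃ σ : inertia p, IsPrimitiveRoot (cyclo p σ : AlgebraicClosure (ZMod p)) (p - 1) ∧
      ∃ t : PadicAlgCl p, t ^ 2 = ((pStar p : ℤ) : PadicAlgCl p) ∧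
        (σ : Gal(PadicAlgCl p/ℚ_[p])) t = -t := by
  have hprime : p.Prime := Fact.out
  have hp2 := hprime.two_le
  obtain ⟨ζ, hζ⟩ := HasEnoughRootsOfUnity.exists_primitiveRoot (PadicAlgCl p) p
  obtain ⟨a, ha⟩ := IsCyclic.exists_generator (α := (ZMod p)ˣ)
  have horder : orderOf a = p - 1 := by
    rw [orderOf_eq_card_of_forall_mem_zpowers ha, Nat.card_eq_fintype_card, ZMod.card_units]
  have hcop : (a : ZMod p).val.Coprime p := ZMod.val_coe_unit_coprime a
  have hroot {ξ : PadicAlgCl p} (hξ : IsPrimitiveRoot ξ p) :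
      aeval (ξ - 1) ((cyclotomic p ℚ_[p]).comp (X + C 1)) = 0 := by
    rw [aeval_comp]
    simp only [map_add, aeval_X, map_one, sub_add_cancel]
    rw [aeval_def, eval₂_eq_eval_map, map_cyclotomic]
    exact hξ.isRoot_cyclotomic hprime.pos
  -- The polynomial is `Φ_p(X + 1)`, of degree `p - 1`, with roots `ζ ^ i - 1`.
  obtain ⟨σ, hσ, hσπ⟩ := exists_mem_inertia_apply_eq (π := ζ - 1) (π' := ζ ^ (a : ZMod p).val - 1)
    (Nat.sub_ne_zero_of_lt hprime.one_lt) (norm_sub_one_pow_of_isPrimitiveRoot hζ)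
    ((cyclotomic.monic p ℚ_[p]).comp_X_add_C 1)
    (by rw [natDegree_comp, natDegree_X_add_C, mul_one, natDegree_cyclotomic,
      Nat.totient_prime hprime]) (hroot hζ) (hroot (hζ.pow_of_coprime _ hcop))
  have hσζ : σ ζ = ζ ^ (a : ZMod p).val := by
    rw [map_sub, map_one] at hσπ
    exact sub_left_injective hσπ
  refine ⟨⟨σ, hσ⟩, ?_, ?_⟩
  · rw [coe_cyclo_eq hζ hσζ]
    refine IsPrimitiveRoot.map_of_injective ?_ (FaithfulSMul.algebraMap_injective _ _)
    rw [IsPrimitiveRoot.coe_units_iff, ← horder]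
    exact IsPrimitiveRoot.orderOf a
  -- The square root of `p*` is the quadratic Gauss sum; `σ` multiplies it by the quadratic
  -- character of `a`, which is `-1` because a generator is not a square.
  · let χ : MulChar (ZMod p) (PadicAlgCl p) :=
      (quadraticChar (ZMod p)).ringHomComp (Int.castRingHom (PadicAlgCl p))
    have hring : ringChar (ZMod p) ≠ 2 := by rwa [ZMod.ringChar_zmod_n]
    have hχ1 : χ ≠ 1 := by
      intro h
      exact quadraticChar_ne_one hring
        ((MulChar.ringHomComp_eq_one_iff (Int.cast_injective (α := PadicAlgCl p))).1 h)
    have hχ2 : χ.IsQuadratic := (quadraticChar_isQuadratic (ZMod p)).comp _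
    have hsq : ¬ IsSquare (a : ZMod p) := by
      rintro ⟨b, hb⟩
      have hb0 : b ≠ 0 := by rintro rfl; exact a.ne_zero (by simp at hb)
      have h1 : a ^ ((p - 1) / 2) = 1 := by
        apply Units.ext
        rw [Units.val_pow_eq_pow_val, hb, ← sq, ← pow_mul,
          Nat.mul_div_cancel' (even_iff_two_dvd.1 (hprime.even_sub_one hp)),
          ZMod.pow_card_sub_one_eq_one hb0, Units.val_one]
      have h2 := Nat.le_of_dvd (by omega) (horder ▸ orderOf_dvd_of_pow_eq_one h1)
      omega
    have hχa : χ a = -1 := by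
      change ((quadraticChar (ZMod p) a : ℤ) : PadicAlgCl p) = -1
      rw [quadraticChar_neg_one_iff_not_isSquare.2 hsq]
      simp
    let e := AddChar.zmodChar p hζ.pow_eq_one
    have he : e.IsPrimitive := AddChar.zmodChar_primitive_of_primitive_root p hζ
    refine ⟨gaussSum χ e, ?_, ?_⟩
    · rw [gaussSum_sq hχ1 hχ2 he, ZMod.card, pStar, legendreSym]
      push_cast
      rfl
    · have h1 : σ (gaussSum χ e) = gaussSum χ (e.mulShift a) := by
        simp only [gaussSum, map_sum, map_mul]
        refine Finset.sum_congr rfl fun x _ => ?_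
        congr 1
        · exact map_intCast σ _
        · rw [AddChar.mulShift_apply, AddChar.zmodChar_apply, map_pow, hσζ, ← pow_mul,
            ← AddChar.zmodChar_apply' hζ.pow_eq_one]
          congr 1
          push_cast
          rw [ZMod.natCast_zmod_val, ZMod.natCast_zmod_val]
      change σ (gaussSum χ e) = _
      rw [h1, gaussSum_mulShift_eq, hχ2.inv, hχa, neg_one_mul]

end Uniformizers

/-! ### Exponents of the inertia characters of a bad dihedral representation. -/

section Weights

variable {p : ℕ} [Fact p.Prime]

/-- `x ^ (2b) = 1` gives `m ∣ 2b ≤ 2m`, and `b = 0` or `b = m` would give `x ^ b = 1`. -/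
theorem two_mul_eq_of_pow_eq_neg_one {K : Type*} [Field K] (h2 : (-1 : K) ≠ 1) {x : K} {m b : ℕ}
    (hx : IsPrimitiveRoot x m) (hb : b ≤ m) (hxb : x ^ b = -1) : 2 * b = m := by
  have hb0 : b ≠ 0 := by
    rintro rfl
    exact h2 (by rw [← hxb, pow_zero])
  have hbm : b ≠ m := by
    rintro rfl
    exact h2 (by rw [← hxb, hx.pow_eq_one])
  obtain ⟨c, hc⟩ := hx.dvd_of_pow_eq_one (2 * b) (by rw [mul_comm, pow_mul, hxb]; norm_num)
  have hc1 : c = 1 := by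
    rcases c with _ | _ | c
    · omega
    · rfl
    · have h3 : m * 2 ≤ m * (c + 1 + 1) := Nat.mul_le_mul_left m (by omega)
      omega
  rw [hc, hc1, mul_one]

theorem neg_one_ne_one_algebraicClosure (hp : p ≠ 2) : (-1 : AlgebraicClosure (ZMod p)) ≠ 1 := by
  have : Fact (2 < p) := ⟨lt_of_le_of_ne (Fact.out : p.Prime).two_le hp.symm⟩
  exact CharP.neg_one_ne_one _ p

variable {r : Gal(PadicAlgCl p/ℚ_[p]) →* GL (Fin 2) (AlgebraicClosure (ZMod p))}

theorem IsDiagonalOnInertia.isTriangularOnInertia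
    {φ φ' : inertia p →* (AlgebraicClosure (ZMod p))ˣ} (h : IsDiagonalOnInertia r φ φ') :
    IsTriangularOnInertia r φ φ' := by
  obtain ⟨P, hP⟩ := h
  exact ⟨P, fun σ => ⟨0, hP σ⟩⟩

theorem IsTriangularOnInertia.trace_eq {φ φ' : inertia p →* (AlgebraicClosure (ZMod p))ˣ}
    (h : IsTriangularOnInertia r φ φ') (σ : inertia p) :
    (r σ).val.trace = φ σ + φ' σ := by
  obtain ⟨P, hP⟩ := h
  obtain ⟨u, hu⟩ := hP σ
  have ht := congrArg Matrix.trace hu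
  rw [Units.val_mul, Matrix.trace_mul_comm, ← Units.val_mul, inv_mul_cancel_left,
    Matrix.trace_fin_two !![_, _; _, _]] at ht
  exact ht

variable {ρ : Gal(AlgebraicClosure ℚ/ℚ) →* GL (Fin 2) (AlgebraicClosure (ZMod p))}
  {ι : AlgebraicClosure ℚ →+* PadicAlgCl p}

theorem IsBadDihedral.add_eq_zero (hbad : IsBadDihedral ρ)
    {φ φ' : inertia p →* (AlgebraicClosure (ZMod p))ˣ}
    (h : IsTriangularOnInertia (ρ.comp (restrict ι)) φ φ') {σ : inertia p} {t : PadicAlgCl p}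
    (ht : t ^ 2 = ((pStar p : ℤ) : PadicAlgCl p))
    (hσ : (σ : Gal(PadicAlgCl p/ℚ_[p])) t = -t) :
    (φ σ + φ' σ : AlgebraicClosure (ZMod p)) = 0 := by
  rw [← h.trace_eq]
  exact trace_eq_zero_of_isBadDihedral hbad (restrict_notMem_galSqrtPStar ι ht hσ)

/-- A bad dihedral representation of niveau one with an unramified character on inertia has the
quadratic character as its other character. -/
theorem IsBadDihedral.two_mul_eq_sub_one (hp : p ≠ 2) (hbad : IsBadDihedral ρ) {b : ℕ}
    (hb : b ≤ p - 1)
    (h : IsTriangularOnInertia (ρ.comp (restrict ι)) (cyclo p ^ b) (cyclo p ^ 0) ∨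
      IsTriangularOnInertia (ρ.comp (restrict ι)) (cyclo p ^ 0) (cyclo p ^ b)) :
    2 * b = p - 1 := by
  obtain ⟨σ, hσ, t, ht, hσt⟩ := exists_isPrimitiveRoot_cyclo hp
  refine two_mul_eq_of_pow_eq_neg_one (neg_one_ne_one_algebraicClosure hp) hσ hb ?_
  have h0 : (cyclo p σ : AlgebraicClosure (ZMod p)) ^ b + 1 = 0 := by
    rcases h with h | h
    · have h1 := hbad.add_eq_zero h ht hσt
      rwa [MonoidHom.pow_apply, MonoidHom.pow_apply, pow_zero, Units.val_one,
        Units.val_pow_eq_pow_val] at h1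
    · have h1 := hbad.add_eq_zero h ht hσt
      rwa [MonoidHom.pow_apply, MonoidHom.pow_apply, pow_zero, Units.val_one,
        Units.val_pow_eq_pow_val, add_comm] at h1
  exact eq_neg_of_add_eq_zero_left h0

/-- The local representation at `p` of a bad dihedral representation of niveau one is tame. -/
theorem IsBadDihedral.isTame (hp : p ≠ 2) (hbad : IsBadDihedral ρ) {α β : ℕ}
    (h : IsTriangularOnInertia (ρ.comp (restrict ι)) (cyclo p ^ β) (cyclo p ^ α)) :
    IsTame (ρ.comp (restrict ι)) := by
  intro σ hσ
  -- `τ` only supplies an element outside the index-two subgroup; `σ` acts unipotently because `χ`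
  -- is trivial on wild inertia.
  obtain ⟨τ, -, t, ht, hτt⟩ := exists_isPrimitiveRoot_cyclo hp
  let τ' : inertia p := ⟨σ, mem_inertia_of_mem_wildInertia hσ⟩
  have hχ (m : ℕ) : ((cyclo p ^ m) τ' : AlgebraicClosure (ZMod p)) = 1 := by
    rw [MonoidHom.pow_apply, cyclo_eq_one_of_mem_wildInertia (σ := τ') hσ, one_pow, Units.val_one]
  obtain ⟨P, hP⟩ := h
  obtain ⟨u, hu⟩ := hP τ'
  rw [hχ β, hχ α] at hu
  exact eq_one_of_isBadDihedral (h := restrict ι σ) hp hbad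
    (restrict_notMem_galSqrtPStar ι ht hτt) hu

/-- Dividing `ψ(σ) ^ (p b) + ψ(σ) ^ b = 0` by `ψ(σ) ^ b` leaves a power of `ψ(σ) ^ (p - 1)`, which
has order `p + 1`. -/
theorem IsBadDihedral.two_mul_eq_add_one (hp : p ≠ 2) (hbad : IsBadDihedral ρ)
    {ψ : inertia p →* (AlgebraicClosure (ZMod p))ˣ} (hψ : IsFundamentalTwo ψ) {b : ℕ}
    (hb : b ≤ p - 1) (h : IsDiagonalOnInertia (ρ.comp (restrict ι)) (ψ ^ (p * b)) (ψ ^ b)) :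
    2 * b = p + 1 := by
  have hprime : p.Prime := Fact.out
  obtain ⟨σ, hσ, t, ht, hσt⟩ := hψ.exists_isPrimitiveRoot hp
  have h0 := hbad.add_eq_zero h.isTriangularOnInertia ht hσt
  have hroot : IsPrimitiveRoot ((ψ σ : AlgebraicClosure (ZMod p)) ^ (p - 1)) (p + 1) :=
    hσ.pow sq_sub_one_pos (by rw [mul_comm, ← Nat.sq_sub_sq, one_pow])
  refine two_mul_eq_of_pow_eq_neg_one (neg_one_ne_one_algebraicClosure hp) hroot (by omega) ?_
  have e : p * b = (p - 1) * b + b := by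
    conv_lhs => rw [← Nat.sub_add_cancel hprime.one_le, add_mul, one_mul]
  simp only [MonoidHom.pow_apply, Units.val_pow_eq_pow_val, Units.val_mul, e, pow_add, pow_mul]
    at h0
  rw [← add_one_mul, mul_eq_zero,
    or_iff_left (pow_ne_zero b (Units.ne_zero (ψ σ)))] at h0
  exact eq_neg_of_add_eq_zero_left h0

/-- Take `n = p b`: then `p n = p ^ 2 b ≡ b` modulo `p ^ 2 - 1`, and `p + 1` is prime to `p` and
exceeds `b`. -/
theorem isNiveauTwo_of_isDiagonalOnInertia {ψ : inertia p →* (AlgebraicClosure (ZMod p))ˣ}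
    (hψ : IsFundamentalTwo ψ) {b : ℕ} (hb0 : 0 < b) (hb : b ≤ p - 1)
    (h : IsDiagonalOnInertia r (ψ ^ (p * b)) (ψ ^ b)) : IsNiveauTwo r := by
  refine ⟨ψ, p * b, hψ, ?_, ?_⟩
  · intro hdvd
    have hcop : (p + 1).Coprime p := by simp
    have := Nat.le_of_dvd hb0 (hcop.dvd_of_dvd_mul_left hdvd)
    omega
  · have hpos := sq_sub_one_pos (p := p)
    have e : p * (p * b) = (p ^ 2 - 1) * b + b := by
      rw [← add_one_mul, Nat.sub_add_cancel (by omega)]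
      ring
    have e' : ψ ^ (p * (p * b)) = ψ ^ b := by
      ext σ
      have h1 : ψ σ ^ (p ^ 2 - 1) = 1 := DFunLike.congr_fun hψ.pow_sq_sub_one σ
      simp only [MonoidHom.pow_apply]
      rw [e, pow_add, pow_mul, h1, one_pow, one_mul]
    rwa [e']

end Weights

end GaloisRep

end

theorem lemma1p2 (p : ℕ) [Fact p.Prime] (hp : p ≠ 2)
    (ρ : Gal(AlgebraicClosure ℚ/ℚ) →* GL (Fin 2) (AlgebraicClosure (ZMod p)))
    (hcont : GaloisRep.IsContinuous ρ)
    (hodd : GaloisRep.IsOdd ρ)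
    (hbad : GaloisRep.IsBadDihedral ρ)
    (ι : AlgebraicClosure ℚ →+* PadicAlgCl p)
    (k : ℕ)
    (hk : GaloisRep.IsSerreWeight (ρ.comp (GaloisRep.restrict ι)) k)
    (hk_range : k ∈ Set.Icc 2 (p + 1)) :
    (GaloisRep.IsNiveauTwo (ρ.comp (GaloisRep.restrict ι)) ∧ (p : ℤ) = 2 * (k : ℤ) - 3) ∨
      (GaloisRep.IsNiveauOne (ρ.comp (GaloisRep.restrict ι)) ∧ (p : ℤ) = 2 * (k : ℤ) - 1) := by
  have hprime : p.Prime := Fact.out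
  obtain ⟨hk2, hkp⟩ := hk_range
  -- Both alternatives give `b ≥ 1`, so `a ≥ 1` would push the weight beyond `p + 1`.
  have small {a b : ℕ} (hab : a < b ∨ a ≤ b ∧ 0 < b) (h : 1 + p * a + b ≤ p + 1) : a = 0 := by
    by_contra ha
    have := Nat.le_mul_of_pos_right p (Nat.pos_of_ne_zero ha)
    omega
  have hone : 1 ≤ p := hprime.one_le
  cases hk with
  | niveauTwo ψ a b hψ hab hb hr =>
    obtain rfl : a = 0 := small (Or.inl hab) hkp
    have e : ψ ^ 0 * (ψ ^ p) ^ b = ψ ^ (p * b) := by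
      ext σ
      simp only [MonoidHom.pow_apply, pow_zero, one_mul, pow_mul]
    have e' : (ψ ^ p) ^ 0 * ψ ^ b = ψ ^ b := by
      ext σ
      simp only [MonoidHom.pow_apply, pow_zero, one_mul]
    rw [e, e'] at hr
    have h := hbad.two_mul_eq_add_one hp hψ hb hr
    refine Or.inl ⟨GaloisRep.isNiveauTwo_of_isDiagonalOnInertia hψ hab hb hr, ?_⟩
    omega
  | niveauOneTame a b hab hb h0 hr =>
    obtain rfl : a = 0 := small (Or.inr ⟨hab, by omega⟩) hkp
    have h := hbad.two_mul_eq_sub_one hp (by omega) (Or.inr hr.isTriangularOnInertia)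
    refine Or.inr ⟨⟨b, 0, hr.isTriangularOnInertia⟩, ?_⟩
    omega
  | niveauOneUnramified hr =>
    -- With `b = 0` the relation becomes `0 = p - 1`: inertia cannot act trivially.
    have h := hbad.two_mul_eq_sub_one hp (Nat.zero_le _) (Or.inr hr.isTriangularOnInertia)
    have := hprime.two_le
    omega
  | niveauOneWild α β hα hβ hβ' hαβ hr hw => exact absurd (hbad.isTame hp hr) hw
  | niveauOnePeu α β hα hβ hβ' hαβ hr hw hpeu => exact absurd (hbad.isTame hp hr) hw
  | niveauOneTres α β hα hβ hβ' hαβ hr hw htres => exact absurd (hbad.isTame hp hr) hw
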